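/- Let $n\ge 0$ and $m\ge 1$ be integers, $A\in\mathbb{R}^{n\times n}$ and $B\in\mathbb{R}^{m\times n}$. For $v,w\in\mathbb{R}^m$ write $v\vartriangleright w$ (resp. $v\vartriangleleft w$) if $v_j>w_j$ (resp. $v_j<w_j$) for all $j\in\{1,\dots,m\}$, and let $P(B)=\{x\in\mathbb{R}^n : Bx\vartriangleright 0\}$. Call $(A,B)$ *trapped* if there is $x\in P(B)$ with $A^kx\in P(B)$ for all integers $k\ge 0$, and *escaping* otherwise. Call $(A,B)$ a *robust escaping* (resp. *robust trapped*) instance if it lies in the interior of the set of escaping (resp. trapped) instances in $\mathbb{R}^{n\times n}\times\mathbb{R}^{m\times n}$ with its Euclidean topology. Let $\sigma(A)\subseteq\mathbb{C}$ be the spectrum of $A$, let $\sigma_{\ge 0}(A)=\sigma(A)\cap[0,+\infty)$, and let $\sigma^{\mathrm{odd}}_{>0}(A)$ be the set of those $\lambda\in\sigma(A)\cap(0,+\infty)$ whose algebraic multiplicity is odd. Let $B_j$ be the $j$-th row of $B$, and let $S^{n-1}\subseteq\mathbb{R}^n$ be the Euclidean unit sphere (empty if $n=0$). Then: 1. $(A,B)$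 is a robust escaping instance if and only if $$\forall\lambda\in\sigma_{\ge 0}(A)\;\forall v\in S^{n-1}\;\bigl(Av=\lambda v\;\Longrightarrow\;\exists j\in\{1,\dots,m\}:\;B_jv<0\bigr).$$ 2. $(A,B)$ is a robust trapped instance if and only if $$\exists\lambda\in\sigma^{\mathrm{odd}}_{>0}(A)\;\forall v\in S^{n-1}\;\bigl(Av=\lambda v\;\Longrightarrow\;(Bv\vartriangleright 0\ \text{ or }\ Bv\vartriangleleft 0)\bigr).$$ -/

import Mathlib

open scoped Matrix

/-- The open polyhedron `P(B) = {x ∈ ℝⁿ | B x ▷ 0}`, where `v ▷ w` means that every coordinate of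
`v` is strictly greater than that of `w`; `StrongLT w v` is Mathlib's name for this relation. -/
def openPolyhedron {m n : ℕ} (B : Matrix (Fin m) (Fin n) ℝ) : Set (Fin n → ℝ) :=
  {x | StrongLT 0 (B *ᵥ x)}

/-- `(A, B)` is trapped if the orbit under `A` of some point of `P(B)` stays in `P(B)`. -/
def IsTrapped {m n : ℕ} (A : Matrix (Fin n) (Fin n) ℝ) (B : Matrix (Fin m) (Fin n) ℝ) : Prop :=
  ∃ x ∈ openPolyhedron B, ∀ k : ℕ, (A ^ k) *ᵥ x ∈ openPolyhedron B

/-- `(A, B)` is escaping if it is not trapped. -/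
def IsEscaping {m n : ℕ} (A : Matrix (Fin n) (Fin n) ℝ) (B : Matrix (Fin m) (Fin n) ℝ) : Prop :=
  ¬ IsTrapped A B

/-- `(A, B)` is robustly trapped if it lies in the interior of the set of trapped instances, in the
Euclidean topology of `ℝ^{n × n} × ℝ^{m × n}`. -/
def IsRobustlyTrapped {m n : ℕ} (A : Matrix (Fin n) (Fin n) ℝ) (B : Matrix (Fin m) (Fin n) ℝ) :
    Prop :=
  (A, B) ∈ interior
    {p : Matrix (Fin n) (Fin n) ℝ × Matrix (Fin m) (Fin n) ℝ | IsTrapped p.1 p.2}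

/-- `(A, B)` is robustly escaping if it lies in the interior of the set of escaping instances. -/
def IsRobustlyEscaping {m n : ℕ} (A : Matrix (Fin n) (Fin n) ℝ) (B : Matrix (Fin m) (Fin n) ℝ) :
    Prop :=
  (A, B) ∈ interior
    {p : Matrix (Fin n) (Fin n) ℝ × Matrix (Fin m) (Fin n) ℝ | IsEscaping p.1 p.2}

/-- A real matrix regarded as a complex matrix. -/
def complexify {n : ℕ} (A : Matrix (Fin n) (Fin n) ℝ) : Matrix (Fin n) (Fin n) ℂ :=
  A.map (fun x : ℝ => (x : ℂ))

/-- `σ_{≥ r}(A)`: the real numbers `l ≥ r` that belong to the (complex) spectrum of `A`. -/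
def spectrumGe {n : ℕ} (r : ℝ) (A : Matrix (Fin n) (Fin n) ℝ) : Set ℝ :=
  {l | (l : ℂ) ∈ spectrum ℂ (complexify A) ∧ r ≤ l}

/-- `σ_{> r}(A)`: the real numbers `l > r` that belong to the (complex) spectrum of `A`. -/
def spectrumGt {n : ℕ} (r : ℝ) (A : Matrix (Fin n) (Fin n) ℝ) : Set ℝ :=
  {l | (l : ℂ) ∈ spectrum ℂ (complexify A) ∧ r < l}

/-- `σ^{odd}_{> r}(A)`: the elements of `σ_{> r}(A)` whose algebraic multiplicity, i.e. whose
multiplicity as a root of the characteristic polynomial, is odd. -/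
def spectrumGtOdd {n : ℕ} (r : ℝ) (A : Matrix (Fin n) (Fin n) ℝ) : Set ℝ :=
  {l | l ∈ spectrumGt r A ∧ Odd ((complexify A).charpoly.rootMultiplicity (l : ℂ))}

/-! ### Perron–Frobenius theory for closed cones. -/

section Cone

open Filter Topology

variable {E : Type*} [NormedAddCommGroup E] [NormedSpace ℝ E] [FiniteDimensional ℝ E]

/-! The link between orbits and spectrum is of Perron–Frobenius type: a trapped instance has an
eigenvector `v ≠ 0` with eigenvalue in `[0, ∞)` and `B v ≥ 0`. Indeed the points whose whole orbit
satisfies the weak inequalities form a closed invariant cone, which contains the trapped point but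
not its negative, so `PointedCone.exists_eigenvector` applies. Conversely, a positive eigenvalue
with `B v ▷ 0` gives a trapped orbit.

Robust escaping: as the sphere is compact, having such a weak eigenvector is a closed condition on
`(A, B)`, so having none is open and forces escape. If there is one, an arbitrarily small rank-one
change makes its eigenvalue and all coordinates of `B v` positive, which traps.

Robust trapping: a root of odd multiplicity is a sign change of the characteristic polynomial, so a
real eigenvalue persists nearby, and by compactness so does the definiteness of `B` on its
eigenvectors. Suppose instead that each positive eigenvalue of odd multiplicity has an indefinite
eigenvector, and let `U` be the span of one such choice. Modulo `U` all positive eigenvalues have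
even multiplicity, so a small perturbation vanishing on `U` removes every eigenvalue in `[0, ∞)`
from the quotient (`exists_perturbation_of_odd_eigenvectors`). The remaining eigenvectors for
eigenvalues in `[0, ∞)` are multiples of the chosen ones. If `m ≥ 2`, a small change of `B` gives
their images coordinates of both strict signs; if `m = 1`, `B` vanishes on `U` and Perron–Frobenius
on the quotient rules out a trapped orbit. -/

theorem PointedCone.iterate_mem {V : Type*} [AddCommGroup V] [Module ℝ V] {C : PointedCone ℝ V}
    {f : V → V} (hf : ∀ y ∈ C, f y ∈ C) (k : ℕ) {y : V} (hy : y ∈ C) : f^[k] y ∈ C := by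
  induction k with
  | zero => simpa using hy
  | succ k ih => rw [Function.iterate_succ_apply']; exact hf _ ih

/-- The Neumann series of an operator preserving a closed cone preserves that cone. -/
theorem PointedCone.inverse_one_sub_apply_mem {C : PointedCone ℝ E} (hC : IsClosed (C : Set E))
    {T : E →L[ℝ] E} (hT : ∀ y ∈ C, T y ∈ C) (h1 : ‖T‖ < 1) {y : E} (hy : y ∈ C) :
    Ring.inverse (1 - T) y ∈ C := by
  have : CompleteSpace E := FiniteDimensional.complete ℝ E
  have hs := (hasSum_geom_series_inverse T h1).mapL (ContinuousLinearMap.apply ℝ E y)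
  refine hC.mem_of_tendsto hs (Eventually.of_forall fun s => C.sum_mem fun i _ => ?_)
  have : (ContinuousLinearMap.apply ℝ E y) (T ^ i) = (⇑T)^[i] y := by
    simp
  rw [this]
  exact PointedCone.iterate_mem hT i hy

/-- Factor `z - h - A = (z - A)(1 - h R(z))`. Since the second factor is inverted by a Neumann
series in `h R(z)`, positivity of the resolvent passes from `z` to slightly smaller parameters. -/
theorem resolvent_sub_eq {A : E →L[ℝ] E} {z h : ℝ} (hz : z ∈ resolventSet ℝ A)
    (hh : ‖h • resolvent A z‖ < 1) :
    resolvent A (z - h) = Ring.inverse (1 - h • resolvent A z) * resolvent A z := by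
  have : CompleteSpace E := FiniteDimensional.complete ℝ E
  have hu : IsUnit (algebraMap ℝ (E →L[ℝ] E) z - A) := hz
  have hv : IsUnit (1 - h • resolvent A z) := (Units.oneSub _ hh).isUnit
  have key : algebraMap ℝ (E →L[ℝ] E) (z - h) - A
      = (algebraMap ℝ (E →L[ℝ] E) z - A) * (1 - h • resolvent A z) := by
    rw [mul_sub, mul_smul_comm, resolvent, Ring.mul_inverse_cancel _ hu, map_sub,
      Algebra.algebraMap_eq_smul_one h]
    noncomm_ring
  have hc : Commute (algebraMap ℝ (E →L[ℝ] E) z - A) (1 - h • resolvent A z) := by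
    have : Commute (algebraMap ℝ (E →L[ℝ] E) z - A) (resolvent A z) := by
      rw [resolvent, commute_iff_eq, Ring.mul_inverse_cancel _ hu, Ring.inverse_mul_cancel _ hu]
    exact (Commute.one_right _).sub_right (this.smul_right h)
  conv_lhs => rw [resolvent, key, Ring.mul_inverse_rev' hc]
  rfl

/-- If `A` preserves a closed cone and `[z, ∞)` lies in the resolvent set of `A`, then the
resolvent of `A` at `z` preserves the cone. -/
theorem PointedCone.resolvent_apply_mem {C : PointedCone ℝ E} (hC : IsClosed (C : Set E))
    {A : E →L[ℝ] E} (hA : ∀ y ∈ C, A y ∈ C) {z : ℝ} (hz : ∀ w, z ≤ w → w ∈ resolventSet ℝ A)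
    {y : E} (hy : y ∈ C) : resolvent A z y ∈ C := by
  have : CompleteSpace E := FiniteDimensional.complete ℝ E
  set M : ℝ := max z (‖A‖ + 1) with hM
  have hMA : ‖A‖ < M := lt_of_lt_of_le (by linarith) (le_max_right _ _)
  have hM0 : 0 < M := (norm_nonneg _).trans_lt hMA
  -- The parameter is `t = -z`, because continuous induction on `[-M, -z]` moves to the right while
  -- the resolvent parameter descends from `M`.
  set S : Set ℝ := {t | ∀ y ∈ C, resolvent A (-t) y ∈ C} with hS
  have hcont : ContinuousOn (fun t : ℝ => resolvent A (-t)) (Set.Icc (-M) (-z)) := by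
    intro t ht
    have hu : IsUnit (algebraMap ℝ (E →L[ℝ] E) (-t) - A) := hz _ (by linarith [ht.2])
    obtain ⟨u, hu⟩ := hu
    have h1 : ContinuousAt Ring.inverse (algebraMap ℝ (E →L[ℝ] E) (-t) - A) := by
      rw [← hu]; exact NormedRing.inverse_continuousAt u
    have h2 : ContinuousAt (fun t : ℝ => algebraMap ℝ (E →L[ℝ] E) (-t) - A) t := by
      have : Continuous (fun t : ℝ => algebraMap ℝ (E →L[ℝ] E) (-t) - A) := by
        simp only [Algebra.algebraMap_eq_smul_one]; fun_prop
      exact this.continuousAt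
    exact (ContinuousAt.comp (f := fun t : ℝ => algebraMap ℝ (E →L[ℝ] E) (-t) - A)
      h1 h2).continuousWithinAt
  have hclosed : IsClosed (S ∩ Set.Icc (-M) (-z)) := by
    have h1 : IsClosed {T : E →L[ℝ] E | ∀ y ∈ C, T y ∈ C} := by
      simp only [Set.ofPred_forall]
      refine isClosed_iInter fun y => isClosed_iInter fun _ => hC.preimage ?_
      fun_prop
    have := hcont.preimage_isClosed_of_isClosed isClosed_Icc h1
    rwa [Set.inter_comm]
  have hstart : -M ∈ S := by
    intro y hy
    have hu : IsUnit (algebraMap ℝ (E →L[ℝ] E) M) := by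
      rw [Algebra.algebraMap_eq_smul_one]
      exact (isUnit_one).smul (Units.mk0 M hM0.ne')
    have hnorm : ‖M⁻¹ • A‖ < 1 := by
      rw [norm_smul, norm_inv, Real.norm_of_nonneg hM0.le, inv_mul_lt_one₀ hM0]; exact hMA
    have hfac : algebraMap ℝ (E →L[ℝ] E) M - A
        = algebraMap ℝ (E →L[ℝ] E) M * (1 - M⁻¹ • A) := by
      rw [mul_sub, mul_one, Algebra.algebraMap_eq_smul_one, smul_mul_smul_comm,
        mul_inv_cancel₀ hM0.ne', one_smul, one_mul]
    have hinv : Ring.inverse (algebraMap ℝ (E →L[ℝ] E) M) = M⁻¹ • 1 := by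
      have : algebraMap ℝ (E →L[ℝ] E) M * (M⁻¹ • 1) = 1 := by
        rw [Algebra.algebraMap_eq_smul_one, smul_mul_smul_comm, mul_inv_cancel₀ hM0.ne', one_smul,
          one_mul]
      calc Ring.inverse (algebraMap ℝ (E →L[ℝ] E) M)
          = Ring.inverse (algebraMap ℝ (E →L[ℝ] E) M)
            * (algebraMap ℝ (E →L[ℝ] E) M * (M⁻¹ • 1)) := by rw [this, mul_one]
        _ = M⁻¹ • 1 := by rw [← mul_assoc, Ring.inverse_mul_cancel _ hu, one_mul]
    have : resolvent A M = M⁻¹ • Ring.inverse (1 - M⁻¹ • A) := by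
      rw [resolvent, hfac, Ring.mul_inverse_rev' (Algebra.commute_algebraMap_left _ _), hinv,
        mul_smul_comm, mul_one]
    rw [neg_neg, this, smul_apply]
    refine C.smul_mem (inv_nonneg.2 hM0.le)
      (PointedCone.inverse_one_sub_apply_mem hC (fun w hw => ?_) hnorm hy)
    exact C.smul_mem (inv_nonneg.2 hM0.le) (hA w hw)
  have hstep : ∀ x ∈ S ∩ Set.Ico (-M) (-z), ∀ b ∈ Set.Ioi x, (S ∩ Set.Ioc x b).Nonempty := by
    rintro x ⟨hxS, hx⟩ b hb
    set r := ‖resolvent A (-x)‖ with hr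
    have hr0 : 0 ≤ r := norm_nonneg _
    set h := min (b - x) (1 / (r + 1)) with hh
    have hpos : 0 < h := lt_min (sub_pos.2 hb) (by positivity)
    have hlt : ‖h • resolvent A (-x)‖ < 1 := by
      rw [norm_smul, Real.norm_of_nonneg hpos.le, ← hr]
      calc h * r ≤ 1 / (r + 1) * r := by gcongr; exact min_le_right _ _
        _ < 1 := by rw [div_mul_eq_mul_div, one_mul, div_lt_one (by positivity)]; linarith
    refine ⟨x + h, fun y hy => ?_, by linarith, by linarith [min_le_left (b - x) (1 / (r + 1))]⟩
    rw [neg_add, ← sub_eq_add_neg, resolvent_sub_eq (hz _ (by linarith [hx.2])) hlt]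
    exact PointedCone.inverse_one_sub_apply_mem hC
      (fun w hw => C.smul_mem hpos.le (hxS w hw)) hlt (hxS y hy)
  have := hclosed.Icc_subset_of_forall_exists_gt hstart hstep
    (Set.right_mem_Icc.2 (neg_le_neg (le_max_left _ _)))
  simpa [hS] using this y hy

/-- At the largest spectral value `p ≥ 0` the positive resolvents must blow up on some vector of the
cone, and the normalised images converge to an eigenvector. The spanning hypothesis ensures that
boundedness on the cone alone would already make `p - A` surjective. -/
theorem PointedCone.exists_eigenvector_of_span_eq_top {C : PointedCone ℝ E}
    (hC : IsClosed (C : Set E)) (hspan : Submodule.span ℝ (C : Set E) = ⊤)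
    {A : E →L[ℝ] E} (hA : ∀ y ∈ C, A y ∈ C) {x : E} (hx : x ∈ C) (hx' : -x ∉ C) :
    ∃ l : ℝ, 0 ≤ l ∧ ∃ v ∈ C, v ≠ 0 ∧ A v = l • v := by
  have : CompleteSpace E := FiniteDimensional.complete ℝ E
  have hres : ∀ z ∈ resolventSet ℝ A, ∀ y, z • resolvent A z y - A (resolvent A z y) = y := by
    intro z hz y
    have := congrArg (fun T : E →L[ℝ] E => T y) (Ring.mul_inverse_cancel _ hz)
    simpa [resolvent, Algebra.algebraMap_eq_smul_one] using this
  have hres' : ∀ z ∈ resolventSet ℝ A, ∀ y, resolvent A z (z • y - A y) = y := by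
    intro z hz y
    have := congrArg (fun T : E →L[ℝ] E => T y) (Ring.inverse_mul_cancel _ hz)
    simpa [resolvent, Algebra.algebraMap_eq_smul_one] using this
  rcases Set.eq_empty_or_nonempty (spectrum ℝ A ∩ Set.Ici 0) with hemp | hne
  · have hz : ∀ w : ℝ, 0 ≤ w → w ∈ resolventSet ℝ A := by
      intro w hw
      by_contra hcon
      exact Set.eq_empty_iff_forall_notMem.1 hemp w ⟨hcon, hw⟩
    -- The resolvent at `0` is `-A⁻¹`; positivity applied to `A x` puts `-x` in the cone.
    have h1 := PointedCone.resolvent_apply_mem hC hA hz (hA x hx)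
    have h2 := hres' 0 (hz 0 le_rfl) (-x)
    rw [zero_smul, zero_sub, map_neg A, neg_neg] at h2
    exact absurd (h2 ▸ h1) hx'
  · obtain ⟨p, ⟨hps, hp0⟩, hpmax⟩ := ((spectrum.isCompact A).inter_right
      isClosed_Ici).exists_isGreatest hne
    have hz : ∀ w : ℝ, p < w → w ∈ resolventSet ℝ A := by
      intro w hw
      by_contra hcon
      exact absurd (hpmax ⟨hcon, le_trans hp0 hw.le⟩) (not_le.2 hw)
    set q : ℕ → ℝ := fun k => p + 1 / ((k : ℝ) + 1) with hq
    have hqp : ∀ k, p < q k := fun k => by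
      have : (0 : ℝ) < 1 / ((k : ℝ) + 1) := Nat.one_div_pos_of_nat
      simp only [hq]; linarith
    have hqt : Tendsto q atTop (𝓝 p) := by
      simpa [hq] using tendsto_one_div_add_atTop_nhds_zero_nat.const_add p
    have hmem : ∀ c ∈ C, ∀ k, resolvent A (q k) c ∈ C := fun c hc k =>
      PointedCone.resolvent_apply_mem hC hA (fun w hw => hz w ((hqp k).trans_le hw)) hc
    by_cases hb : ∀ c ∈ C, ∃ M : ℝ, ∃ᶠ k in atTop, ‖resolvent A (q k) c‖ ≤ M
    · exfalso
      have hrange : ∀ c ∈ C, ∃ w, p • w - A w = c := by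
        intro c hc
        obtain ⟨M, hM⟩ := hb c hc
        obtain ⟨w, -, φ, hφ, hw⟩ := tendsto_subseq_of_frequently_bounded
          (Metric.isBounded_closedBall (x := (0 : E)) (r := M))
          (x := fun k => resolvent A (q k) c) (by simpa using hM)
        refine ⟨w, ?_⟩
        have h1 : Tendsto (fun k => q (φ k) • resolvent A (q (φ k)) c
            - A (resolvent A (q (φ k)) c)) atTop (𝓝 (p • w - A w)) :=
          ((hqt.comp hφ.tendsto_atTop).smul hw).sub ((A.continuous.tendsto w).comp hw)
        have h2 : (fun k => q (φ k) • resolvent A (q (φ k)) c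
            - A (resolvent A (q (φ k)) c)) = fun _ => c := by
          funext k; exact hres _ (hz _ (hqp _)) c
        rw [h2] at h1
        exact tendsto_nhds_unique h1 tendsto_const_nhds
      apply hps
      set T : E →L[ℝ] E := algebraMap ℝ (E →L[ℝ] E) p - A with hT
      have hsurj : Function.Surjective (T : E →ₗ[ℝ] E) := by
        rw [← LinearMap.range_eq_top, eq_top_iff, ← hspan, Submodule.span_le]
        intro c hc
        obtain ⟨w, hw⟩ := hrange c hc
        exact ⟨w, by simpa [hT, Algebra.algebraMap_eq_smul_one] using hw⟩
      have hinj := LinearMap.injective_iff_surjective.2 hsurj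
      exact (ContinuousLinearMap.isUnit_iff_bijective).2 ⟨hinj, hsurj⟩
    · push Not at hb
      obtain ⟨c, hc, hcb⟩ := hb
      set u : ℕ → E := fun k => resolvent A (q k) c with hu
      have hut : Tendsto (fun k => ‖u k‖) atTop atTop := by
        rw [tendsto_atTop]
        intro M
        filter_upwards [hcb M] with k hk using hk.le
      have hev : ∀ᶠ k in atTop, ‖‖u k‖⁻¹ • u k‖ = 1 := by
        filter_upwards [hut.eventually_gt_atTop 0] with k hk
        rw [norm_smul, norm_inv, norm_norm, inv_mul_cancel₀ hk.ne']
      obtain ⟨v, -, φ, hφ, hv⟩ := tendsto_subseq_of_frequently_bounded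
          (Metric.isBounded_closedBall (x := (0 : E)) (r := 1))
          (x := fun k => ‖u k‖⁻¹ • u k)
          (hev.mono fun k hk => by simpa using hk.le).frequently
      refine ⟨p, hp0, v, ?_, ?_, ?_⟩
      · exact hC.mem_of_tendsto hv (Eventually.of_forall fun k =>
          C.smul_mem (inv_nonneg.2 (norm_nonneg _)) (hmem c hc _))
      · have h1 : Tendsto (fun k => ‖((fun k => ‖u k‖⁻¹ • u k) ∘ φ) k‖) atTop (𝓝 1) :=
          tendsto_const_nhds.congr' (((hφ.tendsto_atTop).eventually hev).mono fun k hk => hk.symm)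
        have := tendsto_nhds_unique h1 hv.norm
        intro h0
        simp [h0] at this
      · have h1 : Tendsto (fun k => q (φ k) • (‖u (φ k)‖⁻¹ • u (φ k))
            - A (‖u (φ k)‖⁻¹ • u (φ k))) atTop (𝓝 (p • v - A v)) :=
          ((hqt.comp hφ.tendsto_atTop).smul hv).sub ((A.continuous.tendsto v).comp hv)
        -- Normalising `(q - A) u = c` leaves the right-hand side `c / ‖u‖`, which tends to `0`.
        have h2 : (fun k => q (φ k) • (‖u (φ k)‖⁻¹ • u (φ k))
            - A (‖u (φ k)‖⁻¹ • u (φ k))) = fun k => ‖u (φ k)‖⁻¹ • c := by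
          funext k
          rw [map_smul, smul_comm, ← smul_sub, hres _ (hz _ (hqp _)) c]
        rw [h2] at h1
        have h3 : Tendsto (fun k => ‖u (φ k)‖⁻¹ • c) atTop (𝓝 ((0 : ℝ) • c)) :=
          ((tendsto_inv_atTop_zero.comp (hut.comp hφ.tendsto_atTop))).smul_const c
        have := tendsto_nhds_unique h1 h3
        rw [zero_smul, sub_eq_zero] at this
        exact this.symm

/-- A Perron–Frobenius theorem for closed convex cones that need not be pointed: a linear map
preserving a closed cone that is not a subspace has an eigenvector in the cone, with nonnegative
eigenvalue. -/
theorem PointedCone.exists_eigenvector {C : PointedCone ℝ E} (hC : IsClosed (C : Set E))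
    {A : E →ₗ[ℝ] E} (hA : ∀ y ∈ C, A y ∈ C) {x : E} (hx : x ∈ C) (hx' : -x ∉ C) :
    ∃ l : ℝ, 0 ≤ l ∧ ∃ v ∈ C, v ≠ 0 ∧ A v = l • v := by
  set W : Submodule ℝ E := Submodule.span ℝ (C : Set E) with hW
  have hCW : ∀ y ∈ C, y ∈ W := fun y hy => Submodule.subset_span hy
  have hAW : ∀ y ∈ W, A y ∈ W := by
    intro y hy
    have : W ≤ W.comap A := by
      rw [hW, Submodule.span_le]
      exact fun c hc => hCW _ (hA c hc)
    exact this hy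
  let D : PointedCone ℝ W := C.comap W.subtype
  have hD : ∀ y : W, y ∈ D ↔ (y : E) ∈ C := fun y => Iff.rfl
  have hDc : IsClosed (D : Set W) := hC.preimage continuous_subtype_val
  have hspan : Submodule.span ℝ (D : Set W) = ⊤ := by
    have hcoe : (D : Set W) = (Subtype.val : W → E) ⁻¹' (C : Set E) := rfl
    rw [hcoe]
    exact Submodule.span_span_coe_preimage
  obtain ⟨l, hl, v, hv, hv0, hAv⟩ := PointedCone.exists_eigenvector_of_span_eq_top hDc hspan
    (A := LinearMap.toContinuousLinearMap (A.restrict hAW)) (x := ⟨x, hCW x hx⟩)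
    (fun y hy => hA _ hy) hx hx'
  exact ⟨l, hl, v, hv, fun h => hv0 (Subtype.ext h), by simpa using congrArg Subtype.val hAv⟩

end Cone

/-- If all coordinates of `g` are positive along the orbit of `x` under `f`, then `f` has an
eigenvector with nonnegative eigenvalue on which all coordinates of `g` are nonnegative. -/
theorem exists_nonneg_eigenvector_of_pos_orbit {V ι : Type*} [AddCommGroup V] [Module ℝ V]
    [FiniteDimensional ℝ V] [Nonempty ι] (f : V →ₗ[ℝ] V) (g : V →ₗ[ℝ] (ι → ℝ)) (x : V)
    (hx : ∀ k : ℕ, ∀ i, 0 < g ((f ^ k) x) i) :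
    ∃ l : ℝ, 0 ≤ l ∧ ∃ v, v ≠ 0 ∧ f v = l • v ∧ ∀ i, 0 ≤ g v i := by
  -- Coordinates provide a norm, so that the result also applies to bare quotient spaces.
  let e := (Module.finBasis ℝ V).equivFun
  let A : (Fin (Module.finrank ℝ V) → ℝ) →ₗ[ℝ] (Fin (Module.finrank ℝ V) → ℝ) := e.conj f
  let C : PointedCone ℝ (Fin (Module.finrank ℝ V) → ℝ) :=
    { carrier := {y | ∀ k : ℕ, ∀ i, 0 ≤ g ((f ^ k) (e.symm y)) i}
      add_mem' := fun {a b} ha hb k i => by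
        simpa using add_nonneg (ha k i) (hb k i)
      zero_mem' := fun k i => by simp
      smul_mem' := fun c a ha k i => by
        have : g ((f ^ k) (e.symm (c • a))) i = (c : ℝ) * g ((f ^ k) (e.symm a)) i := by
          have h : c • a = (c : ℝ) • a := rfl
          rw [h, map_smul, map_smul, map_smul, Pi.smul_apply, smul_eq_mul]
        rw [this]
        exact mul_nonneg c.2 (ha k i) }
  have hC : IsClosed (C : Set (Fin (Module.finrank ℝ V) → ℝ)) := by
    have : (C : Set (Fin (Module.finrank ℝ V) → ℝ))
        = ⋂ k : ℕ, ⋂ i, {y | 0 ≤ g ((f ^ k) (e.symm y)) i} := by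
      ext y; simp only [Set.mem_iInter]; rfl
    rw [this]
    refine isClosed_iInter fun k => isClosed_iInter fun i => isClosed_le continuous_const ?_
    exact (LinearMap.proj i ∘ₗ g ∘ₗ (f ^ k) ∘ₗ e.symm.toLinearMap).continuous_of_finiteDimensional
  have hA : ∀ y ∈ C, A y ∈ C := by
    intro y hy k i
    have : (f ^ k) (e.symm (A y)) = (f ^ (k + 1)) (e.symm y) := by
      simp [A, LinearEquiv.conj_apply, pow_succ]
    rw [this]
    exact hy (k + 1) i
  obtain ⟨l, hl, v, hv, hv0, hAv⟩ := PointedCone.exists_eigenvector hC hA (x := e x)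
    (fun k i => by simpa using (hx k i).le) (fun h => by
      obtain ⟨i⟩ := ‹Nonempty ι›
      have h1 := h 0 i
      have h2 := hx 0 i
      simp at h1 h2
      linarith)
  refine ⟨l, hl, e.symm v, by simpa using hv0, ?_, fun i => by simpa using hv 0 i⟩
  have := congrArg e.symm hAv
  simpa [A, LinearEquiv.conj_apply] using this

/-! ### Removing nonnegative eigenvalues by linear perturbation. -/

section Perturbation

open Polynomial

theorem Submodule.span_singleton_le_comap_of_eigenvector {V : Type*} [AddCommGroup V] [Module ℝ V]
    {f : V →ₗ[ℝ] V} {μ : ℝ} {v : V}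
    (hv : f v = μ • v) : Submodule.span ℝ {v} ≤ (Submodule.span ℝ {v}).comap f := by
  rw [Submodule.span_le, Set.singleton_subset_iff]
  exact Submodule.mem_comap.2 (hv ▸ Submodule.smul_mem _ _ (Submodule.mem_span_singleton_self v))

theorem linearIndependent_of_eigenvectors {V : Type*} [AddCommGroup V] [Module ℝ V] {S : Finset ℝ}
    {f : V →ₗ[ℝ] V} {v : S → V}
    (hv : ∀ s, f (v s) = (s : ℝ) • v s) (hv0 : ∀ s, v s ≠ 0) : LinearIndependent ℝ v :=
  Module.End.eigenvectors_linearIndependent' f (fun s : S => (s : ℝ)) Subtype.val_injective v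
    fun s => Module.End.hasEigenvector_iff.2 ⟨Module.End.mem_eigenspace_iff.2 (hv s), hv0 s⟩

theorem Submodule.span_eigenvectors_le_comap {V : Type*} [AddCommGroup V] [Module ℝ V] {S : Finset ℝ}
    {f : V →ₗ[ℝ] V} {v : S → V}
    (hv : ∀ s, f (v s) = (s : ℝ) • v s) :
    Submodule.span ℝ (Set.range v) ≤ (Submodule.span ℝ (Set.range v)).comap f := by
  rw [Submodule.span_le]
  rintro _ ⟨s, rfl⟩
  exact Submodule.mem_comap.2 (hv s ▸ Submodule.smul_mem _ _ (Submodule.subset_span ⟨s, rfl⟩))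

variable {V : Type*} [AddCommGroup V] [Module ℝ V] [FiniteDimensional ℝ V]

theorem LinearMap.charpoly_eq_restrict_mul_mapQ (f : V →ₗ[ℝ] V) (W : Submodule ℝ V)
    (hW : W ≤ W.comap f) :
    f.charpoly = (f.restrict hW).charpoly * (W.mapQ W f hW).charpoly := by
  refine Polynomial.funext fun t => ?_
  rw [eval_mul, LinearMap.eval_charpoly, LinearMap.eval_charpoly, LinearMap.eval_charpoly]
  have h : W ≤ W.comap (algebraMap ℝ (Module.End ℝ V) t - f) := fun x hx => by
    simpa [Module.algebraMap_end_apply] using W.sub_mem (W.smul_mem t hx) (hW hx)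
  rw [LinearMap.det_eq_det_mul_det W _ h]
  congr 2
  exact Submodule.linearMap_qext W (LinearMap.ext fun x => by simp [Module.algebraMap_end_apply])

theorem exists_dual_apply_eq_one {v : V} (hv : v ≠ 0) : ∃ φ : V →ₗ[ℝ] ℝ, φ v = 1 := by
  have : ¬ ∀ φ : Module.Dual ℝ V, φ v = 0 := fun h =>
    hv ((Module.forall_dual_apply_eq_zero_iff ℝ v).1 h)
  push Not at this
  obtain ⟨φ, hφ⟩ := this
  exact ⟨(φ v)⁻¹ • φ, by simp [hφ]⟩

theorem LinearMap.charpoly_eq_mul_mapQ_span_eigenvector {f : V →ₗ[ℝ] V} {μ : ℝ} {v : V}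
    (hv : f v = μ • v) (hv0 : v ≠ 0) :
    f.charpoly = (X - C μ) * ((Submodule.span ℝ {v}).mapQ (Submodule.span ℝ {v}) f
      (Submodule.span_singleton_le_comap_of_eigenvector hv)).charpoly := by
  rw [f.charpoly_eq_restrict_mul_mapQ _ (Submodule.span_singleton_le_comap_of_eigenvector hv)]
  congr 1
  refine Polynomial.funext fun t => ?_
  rw [LinearMap.eval_charpoly]
  have : algebraMap ℝ (Module.End ℝ (Submodule.span ℝ {v})) t
      - f.restrict (Submodule.span_singleton_le_comap_of_eigenvector hv) = (t - μ) • 1 := by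
    ext ⟨x, hx⟩
    obtain ⟨a, rfl⟩ := Submodule.mem_span_singleton.1 hx
    simp [Module.algebraMap_end_apply, hv, sub_smul, smul_comm a]
  rw [this, LinearMap.det_smul, finrank_span_singleton hv0]
  simp

theorem rootMultiplicity_X_sub_C_mul {q : ℝ[X]} (hq : q ≠ 0) (μ ν : ℝ) :
    ((X - C μ) * q).rootMultiplicity ν = (if ν = μ then 1 else 0) + q.rootMultiplicity ν := by
  rw [rootMultiplicity_mul (mul_ne_zero (X_sub_C_ne_zero μ) hq), rootMultiplicity_X_sub_C]

theorem LinearMap.exists_eigenvector_of_rootMultiplicity_ne_zero {f : V →ₗ[ℝ] V} {μ : ℝ}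
    (h : f.charpoly.rootMultiplicity μ ≠ 0) : ∃ v, v ≠ 0 ∧ f v = μ • v := by
  have hr : f.charpoly.IsRoot μ := by
    by_contra hcon
    exact h (rootMultiplicity_eq_zero hcon)
  obtain ⟨v, hv⟩ := (Module.End.hasEigenvalue_iff_isRoot_charpoly f μ |>.2 hr).exists_hasEigenvector
  exact ⟨v, hv.2, hv.apply_eq_smul⟩

/-- Perturbing a `2 × 2` Jordan block inside an invariant plane. -/
theorem eq_zero_of_perturbed_jordan_block {μ ν a σ ε α β : ℝ} (hε : 0 < ε) (hσ : σ * σ = 1)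
    (hσa : σ * a ≤ 0) (h1 : α * μ + β * a - ε * σ * β = ν * α)
    (h2 : β * μ + ε * σ * α = ν * β) : α = 0 ∧ β = 0 := by
  have hσ0 : σ ≠ 0 := by rintro rfl; simp at hσ
  have hβ : β = 0 := by
    by_contra hβ
    -- Eliminating `α` leaves a negative coefficient on the right, against a square on the left.
    have h3 : (ν - μ) ^ 2 * β = (ε * (σ * a) - ε ^ 2) * β := by
      linear_combination (-(ν - μ)) * h2 - ε * σ * h1 - ε ^ 2 * β * hσ
    have h4 := mul_right_cancel₀ hβ h3
    nlinarith [sq_nonneg (ν - μ), mul_nonneg hε.le (neg_nonneg.2 hσa), pow_pos hε 2]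
  subst hβ
  refine ⟨?_, rfl⟩
  have : ε * σ * α = 0 := by linarith
  simpa [hε.ne', hσ0] using this

/-- If every positive eigenvalue of `f` has even multiplicity, then `f` can be perturbed linearly
so as to have no eigenvalue in `[0, ∞)`. -/
theorem exists_perturbation_forall_nonneg_not_eigenvalue (d : ℕ) :
    ∀ {V : Type*} [AddCommGroup V] [Module ℝ V] [FiniteDimensional ℝ V] (f : V →ₗ[ℝ] V),
      Module.finrank ℝ V = d → (∀ μ, 0 < μ → Even (f.charpoly.rootMultiplicity μ)) →
      ∃ D : V →ₗ[ℝ] V, ∀ ε : ℝ, 0 < ε → ∀ μ : ℝ, 0 ≤ μ → ∀ v, f v + ε • D v = μ • v → v = 0 := by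
  induction d using Nat.strong_induction_on with
  | _ d ih =>
  intro V _ _ _ f hd hf
  by_cases h : ∃ μ : ℝ, 0 ≤ μ ∧ ∃ v, v ≠ 0 ∧ f v = μ • v
  swap
  · push Not at h
    refine ⟨0, fun ε _ μ hμ v hv => ?_⟩
    by_contra hv0
    exact h μ hμ v hv0 (by simpa using hv)
  obtain ⟨μ, hμ, v, hv0, hv⟩ := h
  set U := Submodule.span ℝ {v} with hU
  have hUf := Submodule.span_singleton_le_comap_of_eigenvector hv
  set f₁ := U.mapQ U f hUf with hf₁
  have hmk : ∀ x, f₁ (U.mkQ x) = U.mkQ (f x) := fun _ => rfl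
  have hcp : f.charpoly = (X - C μ) * f₁.charpoly :=
    LinearMap.charpoly_eq_mul_mapQ_span_eigenvector hv hv0
  have hmult : ∀ ν, f.charpoly.rootMultiplicity ν
      = (if ν = μ then 1 else 0) + f₁.charpoly.rootMultiplicity ν := fun ν => by
    rw [hcp]; exact rootMultiplicity_X_sub_C_mul f₁.charpoly_monic.ne_zero μ ν
  have hdim : Module.finrank ℝ (V ⧸ U) + 1 = d := by
    have := U.finrank_quotient_add_finrank
    rwa [finrank_span_singleton hv0, hd] at this
  obtain ⟨s, hs⟩ := U.mkQ.exists_rightInverse_of_surjective U.range_mkQ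
  have hs' : ∀ x, U.mkQ (s x) = x := fun x => LinearMap.congr_fun hs x
  obtain ⟨φ, hφ⟩ := exists_dual_apply_eq_one hv0
  have hUmem : ∀ x, U.mkQ x = 0 → ∃ α : ℝ, α • v = x := fun x hx =>
    Submodule.mem_span_singleton.1 ((Submodule.Quotient.mk_eq_zero U).1 hx)
  have hUv : U.mkQ v = 0 :=
    (Submodule.Quotient.mk_eq_zero U).2 (Submodule.mem_span_singleton_self v)
  -- A zero eigenvalue, of any multiplicity, can simply be pushed to `-ε`; a positive one has to be
  -- paired with a second copy of itself.
  rcases hμ.eq_or_lt with rfl | hμ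
  · obtain ⟨D₁, hD₁⟩ := ih _ (by omega) f₁ rfl fun ν hν => by
      have := hf ν hν
      rwa [hmult, if_neg hν.ne', zero_add] at this
    refine ⟨s ∘ₗ D₁ ∘ₗ U.mkQ - φ.smulRight v, fun ε hε ν hν x hx => ?_⟩
    have h1 : U.mkQ x = 0 := hD₁ ε hε ν hν _ <| by
      have := congrArg U.mkQ hx
      simp only [map_add, map_smul, LinearMap.sub_apply, LinearMap.comp_apply, map_sub, hs',
        LinearMap.smulRight_apply, hUv, smul_zero, sub_zero] at this
      rw [hmk, this]
    obtain ⟨α, rfl⟩ := hUmem x h1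
    have h2 := congrArg φ hx
    simp [hv, hUv, hφ] at h2
    have : α * (ν + ε) = 0 := by linarith
    rcases mul_eq_zero.1 this with h | h
    · simp [h]
    · linarith
  -- Even multiplicity minus one is odd, hence nonzero: `μ` is still an eigenvalue of the quotient,
  -- which yields an invariant plane spanned by `v` and `w`.
  · have hodd : Odd (f₁.charpoly.rootMultiplicity μ) := by
      have := hf μ hμ
      rw [hmult, if_pos rfl, add_comm, Nat.even_add_one] at this
      exact Nat.not_even_iff_odd.1 this
    obtain ⟨w₁, hw₁0, hw₁⟩ :=
      LinearMap.exists_eigenvector_of_rootMultiplicity_ne_zero hodd.pos.ne'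
    obtain ⟨w, rfl⟩ := U.mkQ_surjective w₁
    obtain ⟨a, ha⟩ : ∃ a : ℝ, a • v = f w - μ • w := hUmem _ <| by
      rw [map_sub, ← hmk, hw₁, map_smul, sub_self]
    set W := Submodule.span ℝ {U.mkQ w} with hW
    have hWf := Submodule.span_singleton_le_comap_of_eigenvector hw₁
    set f₂ := W.mapQ W f₁ hWf with hf₂
    have hmult₂ : ∀ ν, f₁.charpoly.rootMultiplicity ν
        = (if ν = μ then 1 else 0) + f₂.charpoly.rootMultiplicity ν := fun ν => by
      rw [LinearMap.charpoly_eq_mul_mapQ_span_eigenvector hw₁ hw₁0]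
      exact rootMultiplicity_X_sub_C_mul f₂.charpoly_monic.ne_zero μ ν
    have hdim₂ : Module.finrank ℝ ((V ⧸ U) ⧸ W) + 1 = Module.finrank ℝ (V ⧸ U) := by
      have := W.finrank_quotient_add_finrank
      rwa [finrank_span_singleton hw₁0] at this
    obtain ⟨D₂, hD₂⟩ := ih _ (by omega) f₂ rfl fun ν hν => by
      have := hf ν hν
      rw [hmult, hmult₂] at this
      split_ifs at this
      · rwa [← add_assoc, Nat.even_add, iff_true_left (by decide)] at this
      · simpa using this
    obtain ⟨s₂, hs₂⟩ := W.mkQ.exists_rightInverse_of_surjective W.range_mkQ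
    have hs₂' : ∀ x, W.mkQ (s₂ x) = x := fun x => LinearMap.congr_fun hs₂ x
    have hWw : W.mkQ (U.mkQ w) = 0 :=
      (Submodule.Quotient.mk_eq_zero W).2 (Submodule.mem_span_singleton_self _)
    obtain ⟨ψ₁, hψ₁⟩ := exists_dual_apply_eq_one hw₁0
    obtain ⟨ψ, hψv, hψw⟩ : ∃ ψ : V →ₗ[ℝ] ℝ, ψ v = 0 ∧ ψ w = 1 :=
      ⟨ψ₁ ∘ₗ U.mkQ, by rw [LinearMap.comp_apply, hUv, map_zero], hψ₁⟩
    obtain ⟨χ, hχv, hχw⟩ : ∃ χ : V →ₗ[ℝ] ℝ, χ v = 1 ∧ χ w = 0 :=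
      ⟨φ - φ w • ψ, by simp [hφ, hψv], by simp [hψw]⟩
    obtain ⟨σ, hσ, hσa⟩ : ∃ σ : ℝ, σ * σ = 1 ∧ σ * a ≤ 0 := by
      rcases le_total a 0 with h | h
      · exact ⟨1, by norm_num, by linarith⟩
      · exact ⟨-1, by norm_num, by linarith⟩
    -- On the plane, `D` is the quarter turn `v ↦ σ w`, `w ↦ -σ v`. With `σ a ≤ 0` it turns the
    -- double eigenvalue `μ` into a nonreal pair for every `ε > 0`.
    refine ⟨s ∘ₗ s₂ ∘ₗ D₂ ∘ₗ W.mkQ ∘ₗ U.mkQ + σ • (χ.smulRight w - ψ.smulRight v),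
      fun ε hε ν hν x hx => ?_⟩
    have h1 : W.mkQ (U.mkQ x) = 0 := hD₂ ε hε ν hν _ <| by
      have := congrArg (fun y => W.mkQ (U.mkQ y)) hx
      simp only [map_add, map_smul, LinearMap.sub_apply, LinearMap.comp_apply, map_sub, hs', hs₂',
        LinearMap.smulRight_apply, hUv, hWw, smul_zero, sub_zero, LinearMap.add_apply,
        LinearMap.smul_apply, add_zero] at this
      rw [← this, ← hmk]
      rfl
    obtain ⟨β, hβ⟩ := Submodule.mem_span_singleton.1 ((Submodule.Quotient.mk_eq_zero W).1 h1)
    obtain ⟨α, hα⟩ := hUmem (x - β • w) (by rw [map_sub, map_smul, hβ, sub_self])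
    obtain rfl : x = α • v + β • w := by rw [hα]; abel
    have hfw : f w = μ • w + a • v := by rw [ha]; abel
    have hz : (s ∘ₗ s₂ ∘ₗ D₂ ∘ₗ W.mkQ ∘ₗ U.mkQ) (α • v + β • w) = 0 := by
      simp only [LinearMap.comp_apply, h1, map_zero]
    rw [LinearMap.add_apply, hz, zero_add] at hx
    have h2 := congrArg χ hx
    have h3 := congrArg ψ hx
    simp [hv, hfw, hχv, hχw, hψv, hψw] at h2 h3
    obtain ⟨rfl, rfl⟩ := eq_zero_of_perturbed_jordan_block (α := α) (β := β) (μ := μ) (ν := ν)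
      hε hσ hσa (by linarith) (by linarith)
    simp

theorem LinearMap.charpoly_restrict_span_eigenvectors {S : Finset ℝ} {f : V →ₗ[ℝ] V} {v : S → V}
    (hv : ∀ s, f (v s) = (s : ℝ) • v s) (hli : LinearIndependent ℝ v)
    (hU : Submodule.span ℝ (Set.range v) ≤ (Submodule.span ℝ (Set.range v)).comap f) :
    (f.restrict hU).charpoly = ∏ s : S, (X - C (s : ℝ)) := by
  classical
  let b := Module.Basis.span hli
  have hb : ∀ s, (b s : V) = v s := fun s => congrArg Subtype.val (Module.Basis.span_apply hli s)
  have : LinearMap.toMatrix b b (f.restrict hU) = Matrix.diagonal fun s : S => (s : ℝ) := by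
    ext i j
    have h : f.restrict hU (b j) = (j : ℝ) • b j := Subtype.ext <| by
      rw [LinearMap.coe_restrict_apply, Submodule.coe_smul, hb, hv]
    rw [LinearMap.toMatrix_apply, h, map_smul, Finsupp.smul_apply, Module.Basis.repr_self,
      Matrix.diagonal_apply, Finsupp.single_apply]
    rcases eq_or_ne j i with rfl | hij
    · simp
    · simp [hij, hij.symm]
  rw [← LinearMap.charpoly_toMatrix (f.restrict hU) b, this, Matrix.charpoly_diagonal]

/-- Given one eigenvector for each positive eigenvalue of odd multiplicity, `f` can be perturbed
linearly, without changing it on the span `U` of these eigenvectors, so that the induced map on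
the quotient by `U` has no eigenvalue in `[0, ∞)`. -/
theorem exists_perturbation_of_odd_eigenvectors {S : Finset ℝ} {f : V →ₗ[ℝ] V} {v : S → V}
    (hv : ∀ s, f (v s) = (s : ℝ) • v s) (hv0 : ∀ s, v s ≠ 0)
    (hS : ∀ μ, 0 < μ → (Odd (f.charpoly.rootMultiplicity μ) ↔ μ ∈ S)) :
    ∃ D : V →ₗ[ℝ] V, (∀ s, D (v s) = 0) ∧ ∀ ε : ℝ, 0 < ε → ∀ μ : ℝ, 0 ≤ μ → ∀ x,
      f x + ε • D x - μ • x ∈ Submodule.span ℝ (Set.range v) →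
      x ∈ Submodule.span ℝ (Set.range v) := by
  classical
  set U := Submodule.span ℝ (Set.range v) with hUdef
  have hU : U ≤ U.comap f := Submodule.span_eigenvectors_le_comap hv
  set f₁ := U.mapQ U f hU with hf₁
  have hmk : ∀ x, f₁ (U.mkQ x) = U.mkQ (f x) := fun _ => rfl
  have hcp : f.charpoly = (∏ s ∈ S, (X - C s)) * f₁.charpoly := by
    rw [f.charpoly_eq_restrict_mul_mapQ U hU, LinearMap.charpoly_restrict_span_eigenvectors hv
      (linearIndependent_of_eigenvectors hv hv0) hU, Finset.prod_coe_sort S (fun s => X - C s)]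
  have hprod : ∀ μ, (∏ s ∈ S, (X - C s)).rootMultiplicity μ = if μ ∈ S then 1 else 0 := by
    intro μ
    rw [← count_roots, roots_prod_X_sub_C, Multiset.count_eq_of_nodup S.nodup]
    rfl
  obtain ⟨D₁, hD₁⟩ := exists_perturbation_forall_nonneg_not_eigenvalue _ f₁ rfl fun μ hμ => by
    have := hS μ hμ
    rw [hcp, rootMultiplicity_mul (hcp ▸ f.charpoly_monic.ne_zero), hprod] at this
    split_ifs at this with h
    · have := this.2 h
      rw [add_comm, Nat.odd_add_one] at this
      exact Nat.not_odd_iff_even.1 this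
    · rw [zero_add] at this
      exact Nat.not_odd_iff_even.1 fun ho => h (this.1 ho)
  obtain ⟨s, hs⟩ := U.mkQ.exists_rightInverse_of_surjective U.range_mkQ
  have hs' : ∀ x, U.mkQ (s x) = x := fun x => LinearMap.congr_fun hs x
  refine ⟨s ∘ₗ D₁ ∘ₗ U.mkQ, fun i => ?_, fun ε hε μ hμ x hx => ?_⟩
  · have : U.mkQ (v i) = 0 :=
      (Submodule.Quotient.mk_eq_zero U).2 (Submodule.subset_span ⟨i, rfl⟩)
    simp only [LinearMap.comp_apply, this, map_zero]
  · refine (Submodule.Quotient.mk_eq_zero U).1 (hD₁ ε hε μ hμ (U.mkQ x) ?_)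
    have := (Submodule.Quotient.mk_eq_zero U).2 hx
    rw [← Submodule.mkQ_apply, map_sub, map_add, map_smul, map_smul, LinearMap.comp_apply,
      LinearMap.comp_apply, hs', ← hmk, sub_eq_zero] at this
    exact this

end Perturbation

/-! ### Spectra, the unit sphere, and the two characterisations. -/

section Trapped

open Filter Topology Polynomial

variable {m n : ℕ}

theorem mem_openPolyhedron_iff {B : Matrix (Fin m) (Fin n) ℝ} {x : Fin n → ℝ} :
    x ∈ openPolyhedron B ↔ ∀ j, 0 < (B *ᵥ x) j := Iff.rfl

theorem complexify_charpoly (A : Matrix (Fin n) (Fin n) ℝ) :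
    (complexify A).charpoly = A.charpoly.map Complex.ofRealHom :=
  Matrix.charpoly_map A Complex.ofRealHom

theorem rootMultiplicity_complexify_charpoly (A : Matrix (Fin n) (Fin n) ℝ) (l : ℝ) :
    (complexify A).charpoly.rootMultiplicity (l : ℂ) = A.charpoly.rootMultiplicity l := by
  rw [complexify_charpoly]
  exact (eq_rootMultiplicity_map Complex.ofRealHom.injective l).symm

theorem Matrix.isRoot_charpoly_iff_exists_eigenvector {A : Matrix (Fin n) (Fin n) ℝ} {l : ℝ} :
    A.charpoly.IsRoot l ↔ ∃ v, v ≠ 0 ∧ A *ᵥ v = l • v := by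
  rw [← Matrix.charpoly_toLin', ← Module.End.hasEigenvalue_iff_isRoot_charpoly]
  constructor
  · intro h
    obtain ⟨v, hv⟩ := h.exists_hasEigenvector
    exact ⟨v, hv.2, by simpa using hv.apply_eq_smul⟩
  · rintro ⟨v, hv0, hv⟩
    exact Module.End.hasEigenvalue_of_hasEigenvector
      (Module.End.hasEigenvector_iff.2 ⟨Module.End.mem_eigenspace_iff.2 (by simpa using hv), hv0⟩)

theorem mem_spectrum_complexify_iff {A : Matrix (Fin n) (Fin n) ℝ} {l : ℝ} :
    (l : ℂ) ∈ spectrum ℂ (complexify A) ↔ ∃ v, v ≠ 0 ∧ A *ᵥ v = l • v := by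
  rw [Matrix.mem_spectrum_iff_isRoot_charpoly, ← Matrix.isRoot_charpoly_iff_exists_eigenvector,
    complexify_charpoly]
  exact ⟨fun h => h.of_map Complex.ofRealHom.injective, fun h => h.map (f := Complex.ofRealHom)⟩

theorem exists_pos_smul_dotProduct_self_eq_one {v : Fin n → ℝ} (hv : v ≠ 0) :
    ∃ c : ℝ, 0 < c ∧ (c • v) ⬝ᵥ (c • v) = 1 := by
  have h : 0 < v ⬝ᵥ v := lt_of_le_of_ne (Finset.sum_nonneg fun i _ => mul_self_nonneg (v i))
    fun h => hv (dotProduct_self_eq_zero.1 h.symm)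
  refine ⟨(Real.sqrt (v ⬝ᵥ v))⁻¹, inv_pos.2 (Real.sqrt_pos.2 h), ?_⟩
  rw [smul_dotProduct, dotProduct_smul, smul_eq_mul, smul_eq_mul, ← mul_assoc, ← mul_inv,
    Real.mul_self_sqrt h.le, inv_mul_cancel₀ h.ne']

theorem mem_sphere_iff_dotProduct_self {v : EuclideanSpace ℝ (Fin n)} :
    v ∈ Metric.sphere (0 : EuclideanSpace ℝ (Fin n)) 1 ↔ v.ofLp ⬝ᵥ v.ofLp = 1 := by
  have h : ‖v‖ ^ 2 = v.ofLp ⬝ᵥ v.ofLp := by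
    rw [EuclideanSpace.real_norm_sq_eq]
    exact Finset.sum_congr rfl fun i _ => pow_two _
  rw [mem_sphere_zero_iff_norm, ← h, pow_eq_one_iff_of_nonneg (norm_nonneg v) two_ne_zero]

/-- A property of vectors invariant under positive scaling holds on the Euclidean unit sphere if
and only if it holds for all nonzero vectors. -/
theorem forall_mem_sphere_iff_forall_ne_zero {P : (Fin n → ℝ) → Prop}
    (hP : ∀ c : ℝ, 0 < c → ∀ v, P (c • v) → P v) :
    (∀ v ∈ Metric.sphere (0 : EuclideanSpace ℝ (Fin n)) 1, P v.ofLp) ↔ ∀ v, v ≠ 0 → P v := by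
  constructor
  · intro h v hv
    obtain ⟨c, hc, h1⟩ := exists_pos_smul_dotProduct_self_eq_one hv
    exact hP c hc v (h (WithLp.toLp 2 (c • v)) (mem_sphere_iff_dotProduct_self.2 h1))
  · rintro h v hv
    refine h _ fun h0 => ?_
    rw [mem_sphere_iff_dotProduct_self, h0] at hv
    simp at hv

theorem isCompact_dotProduct_self_eq_one : IsCompact {v : Fin n → ℝ | v ⬝ᵥ v = 1} := by
  refine (isCompact_Icc (a := fun _ : Fin n => (-1 : ℝ)) (b := fun _ => 1)).of_isClosed_subset
    (isClosed_eq (by fun_prop) continuous_const) fun v hv => ?_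
  have h : ∀ i, v i ^ 2 ≤ 1 := fun i => by
    rw [pow_two]
    refine le_of_le_of_eq ?_ hv
    exact Finset.single_le_sum (f := fun i => v i * v i) (fun i _ => mul_self_nonneg (v i))
      (Finset.mem_univ i)
  exact ⟨fun i => (abs_le.1 ((sq_le_one_iff_abs_le_one _).1 (h i))).1,
    fun i => (abs_le.1 ((sq_le_one_iff_abs_le_one _).1 (h i))).2⟩

/-- Projection along a compact factor is a closed map. -/
theorem IsClosed.setOf_exists_dotProduct_self_eq_one {X : Type*} [TopologicalSpace X]
    {K : Set (X × (Fin n → ℝ))} (hK : IsClosed K) :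
    IsClosed {x | ∃ v, v ⬝ᵥ v = 1 ∧ (x, v) ∈ K} := by
  have : CompactSpace {v : Fin n → ℝ | v ⬝ᵥ v = 1} :=
    isCompact_iff_compactSpace.1 isCompact_dotProduct_self_eq_one
  have h1 : IsClosed ((fun p : X × {v : Fin n → ℝ | v ⬝ᵥ v = 1} => (p.1, (p.2 : Fin n → ℝ))) ⁻¹' K) :=
    hK.preimage (by fun_prop)
  have h2 := isClosedMap_fst_of_compactSpace _ h1
  convert h2 using 1
  ext x
  simp

theorem mulVec_pow_of_eigenvector {A : Matrix (Fin n) (Fin n) ℝ} {l : ℝ} {v : Fin n → ℝ}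
    (hv : A *ᵥ v = l • v) (k : ℕ) : (A ^ k) *ᵥ v = l ^ k • v := by
  induction k with
  | zero => simp
  | succ k ih => rw [pow_succ, ← Matrix.mulVec_mulVec, hv, Matrix.mulVec_smul, ih, smul_smul,
      pow_succ']

theorem isTrapped_of_eigenvector {A : Matrix (Fin n) (Fin n) ℝ} {B : Matrix (Fin m) (Fin n) ℝ}
    {l : ℝ} (hl : 0 < l) {v : Fin n → ℝ} (hv : A *ᵥ v = l • v) (hB : ∀ j, 0 < (B *ᵥ v) j) :
    IsTrapped A B := by
  refine ⟨v, hB, fun k => mem_openPolyhedron_iff.2 fun j => ?_⟩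
  rw [mulVec_pow_of_eigenvector hv, Matrix.mulVec_smul]
  exact mul_pos (pow_pos hl k) (hB j)

theorem IsTrapped.exists_nonneg_eigenvector (hm : 1 ≤ m) {A : Matrix (Fin n) (Fin n) ℝ}
    {B : Matrix (Fin m) (Fin n) ℝ} (h : IsTrapped A B) :
    ∃ l : ℝ, 0 ≤ l ∧ ∃ v, v ≠ 0 ∧ A *ᵥ v = l • v ∧ ∀ j, 0 ≤ (B *ᵥ v) j := by
  have : Nonempty (Fin m) := ⟨⟨0, hm⟩⟩
  obtain ⟨x, -, hx⟩ := h
  exact exists_nonneg_eigenvector_of_pos_orbit (Matrix.toLin' A) (Matrix.toLin' B) x fun k j => by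
    rw [← Matrix.toLin'_pow]
    exact hx k j

/-! ### Robust escaping. -/

theorem notMem_interior_of_forall_pos {E : Type*} [TopologicalSpace E] [AddCommGroup E]
    [Module ℝ E] [ContinuousAdd E] [ContinuousSMul ℝ E] {s : Set E} {p d : E}
    (h : ∀ ε : ℝ, 0 < ε → p + ε • d ∉ s) : p ∉ interior s := by
  intro hp
  have hc : Tendsto (fun ε : ℝ => p + ε • d) (𝓝[>] 0) (𝓝 p) := by
    have : Continuous fun ε : ℝ => p + ε • d := by fun_prop
    simpa using (this.tendsto 0).mono_left nhdsWithin_le_nhds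
  obtain ⟨ε, h1, h2⟩ := ((hc.eventually (mem_interior_iff_mem_nhds.1 hp)).and
    self_mem_nhdsWithin).exists
  exact h ε h2 h1

theorem isRobustlyEscaping_iff (hm : 1 ≤ m) {A : Matrix (Fin n) (Fin n) ℝ}
    {B : Matrix (Fin m) (Fin n) ℝ} :
    IsRobustlyEscaping A B ↔
      ∀ l : ℝ, 0 ≤ l → ∀ v, v ≠ 0 → A *ᵥ v = l • v → ∃ j, (B *ᵥ v) j < 0 := by
  constructor
  · intro h l hl v hv0 hv
    by_contra! hB
    have h1 : v ⬝ᵥ v ≠ 0 := fun h => hv0 (dotProduct_self_eq_zero.1 h)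
    -- Since `w ⬝ᵥ v = 1`, the rank-one terms below add `ε` to the eigenvalue of `v` and to each
    -- coordinate of `B v`.
    set w := (v ⬝ᵥ v)⁻¹ • v with hw
    have hwv : w ⬝ᵥ v = 1 := by rw [hw, smul_dotProduct, smul_eq_mul, inv_mul_cancel₀ h1]
    refine notMem_interior_of_forall_pos
      (d := (Matrix.vecMulVec v w, Matrix.vecMulVec (fun _ => 1) w)) (fun ε hε hmem => ?_) h
    refine hmem (isTrapped_of_eigenvector (l := l + ε) (v := v) (by linarith) ?_ fun j => ?_)
    · simp [Matrix.add_mulVec, Matrix.smul_mulVec, Matrix.vecMulVec_mulVec, hwv, hv, add_smul]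
    · have := hB j
      simp [Matrix.add_mulVec, Matrix.smul_mulVec, Matrix.vecMulVec_mulVec, hwv]
      linarith
  · intro h
    -- On unit vectors the eigenvalue is `v ⬝ᵥ A v`, so it need not be a separate, unbounded
    -- variable in the projection.
    set K : Set ((Matrix (Fin n) (Fin n) ℝ × Matrix (Fin m) (Fin n) ℝ) × (Fin n → ℝ)) :=
      {q | q.1.1 *ᵥ q.2 = (q.2 ⬝ᵥ q.1.1 *ᵥ q.2) • q.2 ∧ 0 ≤ q.2 ⬝ᵥ q.1.1 *ᵥ q.2 ∧
        0 ≤ q.1.2 *ᵥ q.2} with hK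
    have hA : Continuous fun q : (Matrix (Fin n) (Fin n) ℝ × Matrix (Fin m) (Fin n) ℝ) × (Fin n → ℝ) =>
        q.1.1 *ᵥ q.2 := continuous_fst.fst.matrix_mulVec continuous_snd
    have hB : Continuous fun q : (Matrix (Fin n) (Fin n) ℝ × Matrix (Fin m) (Fin n) ℝ) × (Fin n → ℝ) =>
        q.1.2 *ᵥ q.2 := continuous_fst.snd.matrix_mulVec continuous_snd
    have hl : Continuous fun q : (Matrix (Fin n) (Fin n) ℝ × Matrix (Fin m) (Fin n) ℝ) × (Fin n → ℝ) =>
        q.2 ⬝ᵥ q.1.1 *ᵥ q.2 := continuous_snd.dotProduct hA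
    have hKc : IsClosed K :=
      (isClosed_eq hA (hl.smul continuous_snd)).inter
        ((isClosed_le continuous_const hl).inter (isClosed_le continuous_const hB))
    have hopen := hKc.setOf_exists_dotProduct_self_eq_one.isOpen_compl
    refine mem_interior.2 ⟨_, fun q hq htr => ?_, hopen, ?_⟩
    · obtain ⟨l, hl, v, hv0, hv, hB⟩ := htr.exists_nonneg_eigenvector hm
      obtain ⟨c, hc, hcv⟩ := exists_pos_smul_dotProduct_self_eq_one hv0
      have hl' : (c • v) ⬝ᵥ q.1 *ᵥ (c • v) = l := by
        rw [Matrix.mulVec_smul, hv, smul_comm, dotProduct_smul, hcv, smul_eq_mul, mul_one]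
      refine hq ⟨c • v, hcv, ?_, ?_, ?_⟩
      · change q.1 *ᵥ (c • v) = ((c • v) ⬝ᵥ q.1 *ᵥ (c • v)) • (c • v)
        rw [hl', Matrix.mulVec_smul, hv, smul_comm]
      · change 0 ≤ (c • v) ⬝ᵥ q.1 *ᵥ (c • v)
        rwa [hl']
      · change 0 ≤ q.2 *ᵥ (c • v)
        rw [Matrix.mulVec_smul]
        exact smul_nonneg hc.le hB
    · rintro ⟨v, hv1, hv, hl, hB⟩
      have hv0 : v ≠ 0 := by rintro rfl; simp at hv1
      obtain ⟨j, hj⟩ := h _ hl v hv0 hv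
      exact absurd (hB j) (not_le.2 hj)

/-! ### Odd multiplicity and definiteness imply robust trapping. -/

theorem Polynomial.exists_eval_mul_eval_neg {p : ℝ[X]} {l : ℝ}
    (h : Odd (p.rootMultiplicity l)) {δ : ℝ} (hδ : 0 < δ) :
    ∃ a b, l - δ < a ∧ a < b ∧ b < l + δ ∧ p.eval a * p.eval b < 0 := by
  have hp : p ≠ 0 := by rintro rfl; simp at h
  obtain ⟨q, hq, hql⟩ := p.exists_eq_pow_rootMultiplicity_mul_and_not_dvd hp l
  have hql : q.eval l ≠ 0 := fun h0 => hql (dvd_iff_isRoot.2 h0)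
  have hcont : Tendsto (fun t : ℝ => q.eval (l - t) * q.eval (l + t)) (𝓝[>] 0)
      (𝓝 (q.eval l * q.eval l)) := by
    have : Continuous (fun t : ℝ => q.eval (l - t) * q.eval (l + t)) := by fun_prop
    simpa using (this.tendsto 0).mono_left nhdsWithin_le_nhds
  have hpos : 0 < q.eval l * q.eval l := mul_self_pos.2 hql
  obtain ⟨t, h1, h2, h3⟩ := ((hcont.eventually (lt_mem_nhds hpos)).and
    (Ioo_mem_nhdsGT hδ)).exists
  refine ⟨l - t, l + t, by linarith, by linarith, by linarith, ?_⟩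
  rw [hq]
  simp only [eval_mul, eval_pow, eval_sub, eval_X, eval_C]
  rw [show l - t - l = -t by ring, show l + t - l = t by ring, h.neg_pow]
  have : 0 < t ^ rootMultiplicity l p := pow_pos h2 _
  nlinarith [mul_pos (mul_pos this this) h1]

theorem not_strongLT_iff_exists_le {a b : Fin m → ℝ} : ¬ StrongLT a b ↔ ∃ i, b i ≤ a i := by
  simp [StrongLT]

theorem isClosed_setOf_indefinite_eigenvector (m n : ℕ) :
    IsClosed {x : (Matrix (Fin n) (Fin n) ℝ × Matrix (Fin m) (Fin n) ℝ) × ℝ |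
      ∃ v, v ⬝ᵥ v = 1 ∧ x.1.1 *ᵥ v = x.2 • v ∧ (∃ i, (x.1.2 *ᵥ v) i ≤ 0) ∧
        ∃ i, 0 ≤ (x.1.2 *ᵥ v) i} := by
  have hA : Continuous fun q : ((Matrix (Fin n) (Fin n) ℝ × Matrix (Fin m) (Fin n) ℝ) × ℝ) ×
      (Fin n → ℝ) => q.1.1.1 *ᵥ q.2 := continuous_fst.fst.fst.matrix_mulVec continuous_snd
  have hB : Continuous fun q : ((Matrix (Fin n) (Fin n) ℝ × Matrix (Fin m) (Fin n) ℝ) × ℝ) ×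
      (Fin n → ℝ) => q.1.1.2 *ᵥ q.2 := continuous_fst.fst.snd.matrix_mulVec continuous_snd
  have h1 : IsClosed (⋃ i : Fin m, {w : Fin m → ℝ | w i ≤ 0}) :=
    isClosed_iUnion_of_finite fun i => isClosed_le (continuous_apply i) continuous_const
  have h2 : IsClosed (⋃ i : Fin m, {w : Fin m → ℝ | 0 ≤ w i}) :=
    isClosed_iUnion_of_finite fun i => isClosed_le continuous_const (continuous_apply i)
  have hK := (isClosed_eq hA (continuous_fst.snd.smul continuous_snd)).inter
    ((h1.inter h2).preimage hB)
  convert hK.setOf_exists_dotProduct_self_eq_one using 1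
  ext x
  simp

/-- A real eigenvalue of odd multiplicity persists under small perturbations. -/
theorem eventually_exists_eigenvector_of_odd {A : Matrix (Fin n) (Fin n) ℝ} {l : ℝ}
    (hodd : Odd (A.charpoly.rootMultiplicity l)) {δ : ℝ} (hδ : 0 < δ) :
    ∀ᶠ M : Matrix (Fin n) (Fin n) ℝ in 𝓝 A, ∃ t ∈ Metric.ball l δ, ∃ v, v ≠ 0 ∧
      M *ᵥ v = t • v := by
  obtain ⟨a, b, ha, hab, hb, hneg⟩ := Polynomial.exists_eval_mul_eval_neg hodd hδ
  have hcont : ∀ t : ℝ, Continuous fun M : Matrix (Fin n) (Fin n) ℝ => M.charpoly.eval t :=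
    fun t => by
      simp only [Matrix.eval_charpoly]
      exact (continuous_const.sub continuous_id).matrix_det
  filter_upwards [((hcont a).mul (hcont b)).continuousAt.eventually (gt_mem_nhds hneg)] with M hM
  have h0 : (0 : ℝ) ∈ Set.uIcc (M.charpoly.eval a) (M.charpoly.eval b) := by
    rw [Set.mem_uIcc]
    rcases mul_neg_iff.1 hM with h | h
    · exact Or.inr ⟨h.2.le, h.1.le⟩
    · exact Or.inl ⟨h.1.le, h.2.le⟩
  obtain ⟨t, ht, hroot⟩ := intermediate_value_uIcc M.charpoly.continuous.continuousOn h0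
  rw [Set.uIcc_of_le hab.le] at ht
  refine ⟨t, ?_, Matrix.isRoot_charpoly_iff_exists_eigenvector.1 hroot⟩
  rw [Real.ball_eq_Ioo]
  exact ⟨ha.trans_le ht.1, ht.2.trans_lt hb⟩

theorem isRobustlyTrapped_of_odd_eigenvalue {A : Matrix (Fin n) (Fin n) ℝ}
    {B : Matrix (Fin m) (Fin n) ℝ} {l : ℝ} (hl : 0 < l) (hodd : Odd (A.charpoly.rootMultiplicity l))
    (h : ∀ v, v ≠ 0 → A *ᵥ v = l • v → StrongLT 0 (B *ᵥ v) ∨ StrongLT (B *ᵥ v) 0) :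
    IsRobustlyTrapped A B := by
  have hopen := (isClosed_setOf_indefinite_eigenvector m n).isOpen_compl
  have hmem : ((A, B), l) ∈ {x : (Matrix (Fin n) (Fin n) ℝ × Matrix (Fin m) (Fin n) ℝ) × ℝ |
      ∃ v, v ⬝ᵥ v = 1 ∧ x.1.1 *ᵥ v = x.2 • v ∧ (∃ i, (x.1.2 *ᵥ v) i ≤ 0) ∧
        ∃ i, 0 ≤ (x.1.2 *ᵥ v) i}ᶜ := by
    rintro ⟨v, hv1, hv, h2, h3⟩
    have hv0 : v ≠ 0 := by rintro rfl; simp at hv1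
    rcases h v hv0 hv with h | h
    · exact not_strongLT_iff_exists_le.2 h2 h
    · exact not_strongLT_iff_exists_le.2 h3 h
  have hev := hopen.mem_nhds hmem
  rw [nhds_prod_eq, mem_prod_iff] at hev
  obtain ⟨N, hN, T, hT, hNT⟩ := hev
  obtain ⟨δ, hδ, hδT⟩ := Metric.mem_nhds_iff.1 (inter_mem hT (lt_mem_nhds hl))
  have hfst := (continuous_fst.tendsto (A, B)).eventually
    (eventually_exists_eigenvector_of_odd hodd hδ)
  refine mem_interior_iff_mem_nhds.2 ?_
  filter_upwards [hN, hfst] with q hqN ⟨t, ht, v, hv0, hv⟩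
  have htT : t ∈ T ∩ {x | 0 < x} := hδT ht
  obtain ⟨c, hc, hcv⟩ := exists_pos_smul_dotProduct_self_eq_one hv0
  have hw : q.1 *ᵥ (c • v) = t • (c • v) := by rw [Matrix.mulVec_smul, hv, smul_comm]
  by_cases h1 : StrongLT 0 (q.2 *ᵥ (c • v))
  · exact isTrapped_of_eigenvector htT.2 hw h1
  by_cases h2 : StrongLT (q.2 *ᵥ (c • v)) 0
  -- A negative definite eigenvector is replaced by its opposite.
  · refine isTrapped_of_eigenvector (v := -(c • v)) htT.2 ?_ fun j => ?_
    · rw [Matrix.mulVec_neg, hw, smul_neg]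
    · rw [Matrix.mulVec_neg]
      exact neg_pos.2 (h2 j)
  exact absurd ⟨c • v, hcv, hw, not_strongLT_iff_exists_le.1 h1, not_strongLT_iff_exists_le.1 h2⟩
    (hNT (Set.mk_mem_prod hqN htT.1))

/-! ### Approximation by escaping instances. -/

theorem exists_ne_nonpos_nonneg (hm : 2 ≤ m) {w : Fin m → ℝ} (h1 : ∃ i, w i ≤ 0)
    (h2 : ∃ i, 0 ≤ w i) : ∃ i j, i ≠ j ∧ w i ≤ 0 ∧ 0 ≤ w j := by
  have : Nontrivial (Fin m) := Fin.nontrivial_iff_two_le.2 hm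
  obtain ⟨i, hi⟩ := h1
  obtain ⟨j, hj⟩ := h2
  rcases ne_or_eq i j with h | rfl
  · exact ⟨i, j, h, hi, hj⟩
  · obtain ⟨k, hk⟩ := exists_ne i
    rcases le_total (w k) 0 with h | h
    · exact ⟨k, i, hk, h, hj⟩
    · exact ⟨i, k, hk.symm, hi, h⟩

/-- An eigenvector of `f` in the span of eigenvectors for distinct eigenvalues is a multiple of one
of them. -/
theorem exists_eq_smul_of_mem_span_eigenvectors {V : Type*} [AddCommGroup V] [Module ℝ V]
    {S : Finset ℝ} {f : V →ₗ[ℝ] V} {v : S → V} (hv : ∀ s, f (v s) = (s : ℝ) • v s)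
    (hv0 : ∀ s, v s ≠ 0) {x : V} (hx : x ∈ Submodule.span ℝ (Set.range v)) (hx0 : x ≠ 0) {l : ℝ}
    (hfx : f x = l • x) : ∃ s, ∃ c : ℝ, c ≠ 0 ∧ x = c • v s := by
  obtain ⟨c, rfl⟩ := (Submodule.mem_span_range_iff_exists_fun ℝ).1 hx
  have h0 : ∑ s, (c s * (s - l)) • v s = 0 := by
    rw [← sub_eq_zero.2 hfx, map_sum, Finset.smul_sum, ← Finset.sum_sub_distrib]
    exact Finset.sum_congr rfl fun s _ => by
      rw [map_smul, hv, smul_smul, smul_smul, ← sub_smul]; ring_nf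
  have h1 := Fintype.linearIndependent_iff.1 (linearIndependent_of_eigenvectors hv hv0) _ h0
  obtain ⟨s, -, hs⟩ := Finset.exists_ne_zero_of_sum_ne_zero hx0
  have hc : c s ≠ 0 := fun h => hs (by rw [h, zero_smul])
  have hsl : (s : ℝ) = l := sub_eq_zero.1 ((mul_eq_zero.1 (h1 s)).resolve_left hc)
  refine ⟨s, c s, hc, Finset.sum_eq_single s (fun t _ hts => ?_) (by simp)⟩
  have : (t : ℝ) - l ≠ 0 := fun h => hts (Subtype.ext (by rw [hsl]; linarith))
  rw [(mul_eq_zero.1 (h1 t)).resolve_right this, zero_smul]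

theorem LinearIndependent.exists_linearMap_apply_eq {ι V W : Type*} [AddCommGroup V] [Module ℝ V]
    [AddCommGroup W] [Module ℝ W] {v : ι → V} (hli : LinearIndependent ℝ v) (d : ι → W) :
    ∃ g : V →ₗ[ℝ] W, ∀ i, g (v i) = d i := by
  obtain ⟨g, hg⟩ := LinearMap.exists_extend ((Module.Basis.span hli).constr ℝ d)
  refine ⟨g, fun i => ?_⟩
  have h := LinearMap.congr_fun hg (Module.Basis.span hli i)
  rw [Module.Basis.constr_basis, LinearMap.comp_apply, Module.Basis.span_apply] at h
  exact h

/-- If every positive eigenvalue of odd multiplicity has an eigenvector `v` such that `B v` is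
neither strictly positive nor strictly negative, then `(A, B)` is a limit of escaping instances. -/
theorem exists_direction_isEscaping (hm : 1 ≤ m) {A : Matrix (Fin n) (Fin n) ℝ}
    {B : Matrix (Fin m) (Fin n) ℝ}
    (h : ∀ l, 0 < l → Odd (A.charpoly.rootMultiplicity l) → ∃ v, v ≠ 0 ∧ A *ᵥ v = l • v ∧
      (∃ i, (B *ᵥ v) i ≤ 0) ∧ ∃ i, 0 ≤ (B *ᵥ v) i) :
    ∃ (D : Matrix (Fin n) (Fin n) ℝ) (G : Matrix (Fin m) (Fin n) ℝ), ∀ ε : ℝ, 0 < ε →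
      IsEscaping (A + ε • D) (B + ε • G) := by
  classical
  set S : Finset ℝ := A.charpoly.roots.toFinset.filter
    fun l => 0 < l ∧ Odd (A.charpoly.rootMultiplicity l) with hSdef
  choose v hv0 hv hneg hpos using fun s : S =>
    h s (Finset.mem_filter.1 s.2).2.1 (Finset.mem_filter.1 s.2).2.2
  have hv' : ∀ s, Matrix.toLin' A (v s) = (s : ℝ) • v s := fun s => hv s
  obtain ⟨D, hDv, hD⟩ := exists_perturbation_of_odd_eigenvectors hv' hv0 fun μ hμ => by
    rw [Matrix.charpoly_toLin', hSdef, Finset.mem_filter, Multiset.mem_toFinset,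
      mem_roots A.charpoly_monic.ne_zero]
    refine ⟨fun ho => ⟨?_, hμ, ho⟩, fun h => h.2.2⟩
    exact (rootMultiplicity_pos A.charpoly_monic.ne_zero).1 ho.pos
  set U := Submodule.span ℝ (Set.range v) with hU
  have hlin : ∀ (ε : ℝ) (x : Fin n → ℝ), Matrix.toLin' (A + ε • LinearMap.toMatrix' D) x
      = Matrix.toLin' A x + ε • D x := fun ε x => by
    rw [map_add, map_smul, Matrix.toLin'_toMatrix', LinearMap.add_apply, LinearMap.smul_apply]
  have hDU : ∀ x ∈ U, D x = 0 := fun x hx => by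
    have : U ≤ LinearMap.ker D := by
      rw [hU, Submodule.span_le]
      rintro _ ⟨s, rfl⟩
      exact hDv s
    exact this hx
  rcases hm.eq_or_lt with rfl | hm2
  · refine ⟨LinearMap.toMatrix' D, 0, fun ε hε htr => ?_⟩
    rw [smul_zero, add_zero] at htr
    obtain ⟨x, -, hx⟩ := htr
    set f := Matrix.toLin' (A + ε • LinearMap.toMatrix' D) with hf
    have hBU : U ≤ LinearMap.ker (Matrix.toLin' B) := by
      rw [hU, Submodule.span_le]
      rintro _ ⟨s, rfl⟩
      obtain ⟨i, hi⟩ := hneg s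
      obtain ⟨j, hj⟩ := hpos s
      refine LinearMap.mem_ker.2 (funext fun k => ?_)
      rw [Subsingleton.elim i k] at hi
      rw [Subsingleton.elim j k] at hj
      exact le_antisymm hi hj
    have hfU : U ≤ U.comap f := fun y hy => by
      rw [Submodule.mem_comap, hlin, hDU y hy, smul_zero, add_zero]
      exact Submodule.span_eigenvectors_le_comap hv' hy
    -- With a single row, indefinite means `B v = 0`, so `B` descends to the quotient by `U`, where
    -- a trapped orbit would produce an eigenvalue in `[0, ∞)`.
    obtain ⟨l, hl, q, hq0, hq, -⟩ := exists_nonneg_eigenvector_of_pos_orbit (U.mapQ U f hfU)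
      (U.liftQ (Matrix.toLin' B) hBU) (U.mkQ x) fun k i => by
        rw [← Submodule.mapQ_pow U hfU, Submodule.mkQ_apply, Submodule.mapQ_apply,
          Submodule.liftQ_apply, hf, ← Matrix.toLin'_pow]
        exact hx k i
    obtain ⟨y, rfl⟩ := U.mkQ_surjective q
    refine hq0 ((Submodule.Quotient.mk_eq_zero U).2 (hD ε hε l hl y ?_))
    rw [← hlin, ← hf, ← Submodule.Quotient.mk_eq_zero U]
    exact sub_eq_zero.2 hq
  · choose i j hij hi hj using fun s => exists_ne_nonpos_nonneg hm2 (hneg s) (hpos s)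
    -- The perturbation of `B` lowers a nonpositive coordinate of `B v` and raises a different,
    -- nonnegative one. With both strict signs present, no nonzero multiple of `v`, of either sign,
    -- has a nonnegative image.
    obtain ⟨g, hg⟩ := (linearIndependent_of_eigenvectors hv' hv0).exists_linearMap_apply_eq
      fun s => (Pi.single (j s) 1 - Pi.single (i s) 1 : Fin m → ℝ)
    refine ⟨LinearMap.toMatrix' D, LinearMap.toMatrix' g, fun ε hε htr => ?_⟩
    obtain ⟨l, hl, x, hx0, hx, hB⟩ := htr.exists_nonneg_eigenvector hm
    rw [← Matrix.toLin'_apply, hlin] at hx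
    have hxU : x ∈ U := hD ε hε l hl x (by rw [hx, sub_self]; exact U.zero_mem)
    rw [hDU x hxU, smul_zero, add_zero] at hx
    obtain ⟨s, c, hc, rfl⟩ := exists_eq_smul_of_mem_span_eigenvectors hv' hv0 hxU hx0 hx
    have hBk : ∀ k, ((B + ε • LinearMap.toMatrix' g) *ᵥ (c • v s)) k
        = c * ((B *ᵥ v s) k + ε * ((Pi.single (j s) 1 - Pi.single (i s) 1 : Fin m → ℝ) k)) := by
      intro k
      rw [Matrix.mulVec_smul, Matrix.add_mulVec, Matrix.smul_mulVec, LinearMap.toMatrix'_mulVec, hg]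
      rfl
    have h1 := hB (i s)
    have h2 := hB (j s)
    rw [hBk] at h1 h2
    simp only [Pi.sub_apply, Pi.single_eq_same, Pi.single_eq_of_ne (hij s),
      Pi.single_eq_of_ne (hij s).symm] at h1 h2
    have h3 : (B *ᵥ v s) (i s) + ε * (0 - 1) < 0 := by linarith [hi s]
    have h4 : 0 < (B *ᵥ v s) (j s) + ε * (1 - 0) := by linarith [hj s]
    rcases lt_or_gt_of_ne hc with hc | hc
    · nlinarith
    · nlinarith

theorem isRobustlyTrapped_iff (hm : 1 ≤ m) {A : Matrix (Fin n) (Fin n) ℝ}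
    {B : Matrix (Fin m) (Fin n) ℝ} :
    IsRobustlyTrapped A B ↔ ∃ l : ℝ, 0 < l ∧ Odd (A.charpoly.rootMultiplicity l) ∧
      ∀ v, v ≠ 0 → A *ᵥ v = l • v → StrongLT 0 (B *ᵥ v) ∨ StrongLT (B *ᵥ v) 0 := by
  constructor
  · intro h
    by_contra! hcon
    obtain ⟨D, G, hDG⟩ := exists_direction_isEscaping hm fun l hl ho => by
      obtain ⟨v, hv0, hv, h1, h2⟩ := hcon l hl ho
      exact ⟨v, hv0, hv, not_strongLT_iff_exists_le.1 h1, not_strongLT_iff_exists_le.1 h2⟩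
    refine notMem_interior_of_forall_pos (p := (A, B)) (d := (D, G)) (fun ε hε => ?_) h
    exact hDG ε hε
  · rintro ⟨l, hl, ho, h⟩
    exact isRobustlyTrapped_of_odd_eigenvalue hl ho h

theorem mulVec_smul_eq_smul_iff {A : Matrix (Fin n) (Fin n) ℝ} {l c : ℝ} (hc : 0 < c)
    {v : Fin n → ℝ} : A *ᵥ (c • v) = l • (c • v) ↔ A *ᵥ v = l • v := by
  rw [Matrix.mulVec_smul, smul_comm l c, smul_right_inj hc.ne']

end Trapped

theorem theorem1p2 (m n : ℕ) (hm : 1 ≤ m)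
    (A : Matrix (Fin n) (Fin n) ℝ) (B : Matrix (Fin m) (Fin n) ℝ) :
    (IsRobustlyEscaping A B ↔
      ∀ l ∈ spectrumGe 0 A, ∀ v ∈ Metric.sphere (0 : EuclideanSpace ℝ (Fin n)) 1,
        A *ᵥ v.ofLp = l • v.ofLp → ∃ j : Fin m, B.row j ⬝ᵥ v.ofLp < 0) ∧
    (IsRobustlyTrapped A B ↔
      ∃ l ∈ spectrumGtOdd 0 A, ∀ v ∈ Metric.sphere (0 : EuclideanSpace ℝ (Fin n)) 1,
        A *ᵥ v.ofLp = l • v.ofLp →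
          StrongLT 0 (B *ᵥ v.ofLp) ∨ StrongLT (B *ᵥ v.ofLp) 0) := by
  constructor
  · rw [isRobustlyEscaping_iff hm]
    have key : ∀ l : ℝ, (∀ v ∈ Metric.sphere (0 : EuclideanSpace ℝ (Fin n)) 1,
        A *ᵥ v.ofLp = l • v.ofLp → ∃ j : Fin m, B.row j ⬝ᵥ v.ofLp < 0) ↔
        ∀ v, v ≠ 0 → A *ᵥ v = l • v → ∃ j : Fin m, (B *ᵥ v) j < 0 := fun l => by
      refine forall_mem_sphere_iff_forall_ne_zero
        (P := fun v => A *ᵥ v = l • v → ∃ j : Fin m, (B *ᵥ v) j < 0) fun c hc v h hv => ?_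
      obtain ⟨j, hj⟩ := h ((mulVec_smul_eq_smul_iff hc).2 hv)
      rw [Matrix.mulVec_smul, Pi.smul_apply, smul_eq_mul] at hj
      exact ⟨j, neg_of_mul_neg_right hj hc.le⟩
    constructor
    · exact fun h l hl => (key l).2 (h l hl.2)
    · exact fun h l hl v hv0 hv =>
        (key l).1 (h l ⟨mem_spectrum_complexify_iff.2 ⟨v, hv0, hv⟩, hl⟩) v hv0 hv
  · rw [isRobustlyTrapped_iff hm]
    have key : ∀ l : ℝ, (∀ v ∈ Metric.sphere (0 : EuclideanSpace ℝ (Fin n)) 1,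
        A *ᵥ v.ofLp = l • v.ofLp → StrongLT 0 (B *ᵥ v.ofLp) ∨ StrongLT (B *ᵥ v.ofLp) 0) ↔
        ∀ v, v ≠ 0 → A *ᵥ v = l • v → StrongLT 0 (B *ᵥ v) ∨ StrongLT (B *ᵥ v) 0 := fun l => by
      refine forall_mem_sphere_iff_forall_ne_zero
        (P := fun v => A *ᵥ v = l • v → StrongLT 0 (B *ᵥ v) ∨ StrongLT (B *ᵥ v) 0)
        fun c hc v h hv => ?_
      rcases h ((mulVec_smul_eq_smul_iff hc).2 hv) with h | h
      · exact Or.inl fun j => (mul_pos_iff_of_pos_left hc).1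
          (by simpa [Matrix.mulVec_smul] using h j)
      · exact Or.inr fun j => neg_of_mul_neg_right
          (by simpa [Matrix.mulVec_smul] using h j) hc.le
    constructor
    · rintro ⟨l, hl, ho, h⟩
      refine ⟨l, ⟨⟨mem_spectrum_complexify_iff.2 ?_, hl⟩, ?_⟩, (key l).2 h⟩
      · exact Matrix.isRoot_charpoly_iff_exists_eigenvector.1
          ((Polynomial.rootMultiplicity_pos A.charpoly_monic.ne_zero).1 ho.pos)
      · rwa [rootMultiplicity_complexify_charpoly]
    · rintro ⟨l, ⟨⟨-, hl⟩, ho⟩, h⟩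
      rw [rootMultiplicity_complexify_charpoly] at ho
      exact ⟨l, hl, ho, (key l).1 h⟩
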